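/- Let $k>1$ be an integer not divisible by $4$, let $n=2k$, and let $\mathrm{Tr}_n:\mathbb F_{3^n}\to\mathbb F_3$ be the absolute trace. Let $I$ be a primitive fourth root of unity in $\mathbb F_{3^n}$. Choose $a_1,a_2,a_3\in\mathbb F_{3^n}$ as follows (either choice of the sign of $a_2$ being allowed): - if $k$ is odd, $a_1=a_3=1$ and $a_2=\pm I$; - if $k$ is even, $a_1=\alpha^{3^k+2}$, $a_3=\alpha$ and $a_2=\pm I\,a_1^{-(3^k-3)/2}$, where $\alpha$ is any primitive element (generator of the multiplicative group) of $\mathbb F_{3^n}$. Then the function $f:\mathbb F_{3^n}\to\mathbb F_3$, $$f(x)=\mathrm{Tr}_n\big(a_1x^{2\cdot 3^k+4}+a_2x^{3^k+5}+a_3x^2\big),$$ is a regular bent function of algebraic degree four that belongs to the completed Maiorana–McFarland class. Here, with $\omega=e^{2\pi i/3}$ and $S_f(b)=\sum_{x\in\mathbb F_{3^n}}\omega^{f(x)-\mathrm{Tr}_n(bx)}$, $f$ is *bent* if $|S_f(b)|^2=3^n$ for all $b\in\mathbb F_{3^n}$, and a bent $f$ is *regular* if there is a function $f^*:\mathbb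 F_{3^n}\to\mathbb F_3$ with $3^{-n/2}S_f(b)=\omega^{f^*(b)}$ for all $b$. The *algebraic degree* is the total degree of the unique polynomial over $\mathbb F_3$, of degree at most $2$ in each of $n$ variables, that represents $f$ in the coordinates of a basis of $\mathbb F_{3^n}$ over $\mathbb F_3$ (it does not depend on the basis). The *completed Maiorana–McFarland class* consists of all functions of the form $a\,(h\circ L)+l$, where $h(x,y)=x\cdot\pi(y)+g(y)$ on $\mathbb F_3^m\times\mathbb F_3^m$ for some $m$, with $\pi$ a permutation of $\mathbb F_3^m$ and $g:\mathbb F_3^m\to\mathbb F_3$ arbitrary, $L$ is a bijective $\mathbb F_3$-affine map from $\mathbb F_{3^n}$ onto $\mathbb F_3^m\times\mathbb F_3^m$, $l:\mathbb F_{3^n}\to\mathbb F_3$ is affine, and $a\in\mathbb F_3\setminus\{0\}$. -/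

import Mathlib

noncomputable section

open MvPolynomial

/-- The Walsh transform `S_f(b) = ∑ x, ω ^ (f x - Tr (b x))` of a function `f : F → 𝔽_p` on a finite
extension `F` of `𝔽_p`. Here `ZMod.stdAddChar j = exp (2 π i j / p) = ω ^ j`, and the trace is
the absolute one. -/
def walsh {p : ℕ} [Fact p.Prime] {F : Type*} [Field F] [Fintype F] [Algebra (ZMod p) F]
    (f : F → ZMod p) (b : F) : ℂ :=
  ∑ x : F, ZMod.stdAddChar (f x - Algebra.trace (ZMod p) F (b * x))

/-- `f` is bent: `|S_f(b)|² = p ^ n` for all `b`, where `n = [F : 𝔽_p]`. -/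
def IsBent {p : ℕ} [Fact p.Prime] {F : Type*} [Field F] [Fintype F] [Algebra (ZMod p) F]
    (f : F → ZMod p) : Prop :=
  ∀ b : F, ‖walsh f b‖ ^ 2 = (p : ℝ) ^ Module.finrank (ZMod p) F

/-- `f` is regular bent: it is bent and `p ^ (-n / 2) S_f(b) = ω ^ f*(b)` for all `b`, for some
function `f* : F → 𝔽_p`. -/
def IsRegularBent {p : ℕ} [Fact p.Prime] {F : Type*} [Field F] [Fintype F] [Algebra (ZMod p) F]
    (f : F → ZMod p) : Prop :=
  IsBent f ∧ ∃ fstar : F → ZMod p, ∀ b : F,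
    (((p : ℝ) ^ (-(Module.finrank (ZMod p) F : ℝ) / 2) : ℝ) : ℂ) * walsh f b
      = ZMod.stdAddChar (fstar b)

/-- `f : E → 𝔽_p` has algebraic degree `d`: in the coordinates of a basis of `E` over `𝔽_p`, `f` is
given by a polynomial of degree at most `p - 1` in each variable (its unique reduced form) of total
degree `d`. The degree does not depend on the basis; all bases are required here. -/
def HasAlgebraicDegree {p : ℕ} [Fact p.Prime] {E : Type*} [AddCommGroup E] [Module (ZMod p) E]
    (f : E → ZMod p) (d : ℕ) : Prop :=
  ∀ B : Module.Basis (Fin (Module.finrank (ZMod p) E)) (ZMod p) E,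
    ∃ P : MvPolynomial (Fin (Module.finrank (ZMod p) E)) (ZMod p),
      P ∈ restrictDegree (Fin (Module.finrank (ZMod p) E)) (ZMod p) (p - 1) ∧
      P.totalDegree = d ∧ ∀ x : E, f x = eval (fun i => B.repr x i) P

/-- Extended-affine equivalence: `g = a (f ∘ L) + l` with `L` a bijective affine map, `l` an affine
function and `a ∈ 𝔽_p` nonzero. The two domains are `𝔽_p`-spaces that need not be literally equal,
so that a field of order `p ^ n` may be identified with `𝔽_p ^ n` along any linear isomorphism. -/
def EAEquivalent {p : ℕ} [Fact p.Prime] {E E' : Type*} [AddCommGroup E] [Module (ZMod p) E]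
    [AddCommGroup E'] [Module (ZMod p) E'] (f : E → ZMod p) (g : E' → ZMod p) : Prop :=
  ∃ (L : E' ≃ᵃ[ZMod p] E) (l : E' →ᵃ[ZMod p] ZMod p) (a : ZMod p),
    a ≠ 0 ∧ ∀ x : E', g x = a * f (L x) + l x

/-- The Maiorana-McFarland function `(x, y) ↦ x · π(y) + g(y)` on `𝔽_p ^ m × 𝔽_p ^ m`. -/
def maioranaMcFarland {p m : ℕ} (π : Equiv.Perm (Fin m → ZMod p)) (g : (Fin m → ZMod p) → ZMod p)
    (z : (Fin m → ZMod p) × (Fin m → ZMod p)) : ZMod p :=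
  z.1 ⬝ᵥ π z.2 + g z.2

/-- `f` lies in the completed Maiorana-McFarland class, that is, the union of the EA-equivalence
classes of the Maiorana-McFarland functions. -/
def InCompletedMaioranaMcFarland {p : ℕ} [Fact p.Prime] {E : Type*} [AddCommGroup E]
    [Module (ZMod p) E] (f : E → ZMod p) : Prop :=
  ∃ (m : ℕ) (π : Equiv.Perm (Fin m → ZMod p)) (g : (Fin m → ZMod p) → ZMod p),
    EAEquivalent (maioranaMcFarland π g) f

/-- The trinomial `f(x) = Tr (a₁ x ^ (2 · 3 ^ k + 4) + a₂ x ^ (3 ^ k + 5) + a₃ x ^ 2)`. -/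
def trinomial {F : Type*} [Field F] [Algebra (ZMod 3) F] (k : ℕ) (a₁ a₂ a₃ : F) (x : F) : ZMod 3 :=
  Algebra.trace (ZMod 3) F (a₁ * x ^ (2 * 3 ^ k + 4) + a₂ * x ^ (3 ^ k + 5) + a₃ * x ^ 2)

/-- The admissible coefficients, for a primitive fourth root of unity `I` and, if `k` is even,
a primitive element `α` of the field `F` of order `3 ^ (2 k)`. The sign of `a₂` is arbitrary. -/
def IsTrinomialCoeff {F : Type*} [Field F] (k : ℕ) (a₁ a₂ a₃ : F) : Prop :=
  ∃ I : F, IsPrimitiveRoot I 4 ∧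
    ((Odd k ∧ a₁ = 1 ∧ a₃ = 1 ∧ (a₂ = I ∨ a₂ = -I)) ∨
     (Even k ∧ ∃ α : F, IsPrimitiveRoot α (3 ^ (2 * k) - 1) ∧
        a₁ = α ^ (3 ^ k + 2) ∧ a₃ = α ∧
        (a₂ = I * (a₁ ^ ((3 ^ k - 3) / 2))⁻¹ ∨ a₂ = -(I * (a₁ ^ ((3 ^ k - 3) / 2))⁻¹))))

end

/-!
Write `q = 3 ^ k` and `σ x = x ^ q`, an involution of `F`. For both parities of `k` there are `κ`
and `α ≠ 0` with `κ σ(κ) = 1`, `σ(α) = -κ² α` and `a₁ = α² σ(α)`, `a₂ = κ α³`, `a₃ = α`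
(`IsTrinomialCoeff.exists_twist`). The `𝔽₃`-linear map `x ↦ κ σ(x)` is then an involution too, and
`F` is the direct sum of its eigenspaces for `1` and `-1`, each of dimension `k`. In the coordinates
`s = x + κ σ(x)` and `d = x - κ σ(x)` the argument of the trace, added to its conjugate, becomes
`α³ s⁵ d - (α s d)³ + α s d`, and the last two terms have opposite traces. Hence,
as `2 = -1` in `𝔽₃`, `f(x) = -Tr (α³ s⁵ d)` (`trace_trinomial_eq`).

This is linear in `d`, and `s ↦ Tr (α³ s⁵ ·)` is a bijection onto the dual of the `-1`-eigenspace
because the trace pairing is nondegenerate and `5` is prime to `q - 1` exactly when `4 ∤ k`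
(`eq_of_forall_trace_pow_five_eq`). So `f` is, up to a linear change of coordinates, a
Maiorana–McFarland function, and these are regular bent by summing over `d` first
(`exists_walsh_eq_of_maioranaMcFarland`).

As `s⁵ = s³ · s · s` is a product of three linear maps, `f` has degree at most four. The degree is
not smaller, since for `t` in the fixed field of `σ` with `t³ ≠ t` the restriction of `f` to a
suitable three-dimensional space spanned by `γ`, `t γ`, `δ` contains the monomial `c₀² c₁ c₂`, which
the Chevalley–Warning summation detects (`four_le_totalDegree_of_eval_eq`). Such a `t` exists
because `k > 1`.
-/

open MvPolynomial

/-! ### Maiorana–McFarland functions are regular bent -/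

lemma sum_stdAddChar_dotProduct {p : ℕ} [Fact p.Prime] {m : ℕ} (w : Fin m → ZMod p) :
    ∑ z : Fin m → ZMod p, (ZMod.stdAddChar (z ⬝ᵥ w) : ℂ) = if w = 0 then (p : ℂ) ^ m else 0 := by
  split_ifs with hw
  · simp [hw, ZMod.card]
  · let ψ : AddChar (Fin m → ZMod p) ℂ :=
      (ZMod.stdAddChar (N := p)).compAddMonoidHom
        { toFun := fun z => z ⬝ᵥ w
          map_zero' := zero_dotProduct w
          map_add' := fun z z' => add_dotProduct z z' w }
    have hψ : ψ ≠ 0 := by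
      obtain ⟨i, hi⟩ := Function.ne_iff.mp hw
      intro h
      have h1 : ψ (Pi.single i (w i)⁻¹) = 1 := by rw [h, AddChar.zero_apply]
      have h2 : ψ (Pi.single i (w i)⁻¹) = ZMod.stdAddChar (Pi.single i (w i)⁻¹ ⬝ᵥ w) := rfl
      rw [h2, single_dotProduct, inv_mul_cancel₀ hi] at h1
      exact one_ne_zero (ZMod.injective_stdAddChar (h1.trans (AddChar.map_zero_eq_one _).symm))
    exact AddChar.sum_eq_zero_iff_ne_zero.mpr hψ

/-- The Walsh transform of a Maiorana–McFarland function is computed by summing over the first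
component first: the only `y` that contributes is the preimage under `π` of the functional
`x ↦ Tr (b x)` on the first factor. -/
lemma exists_walsh_eq_of_maioranaMcFarland {p : ℕ} [Fact p.Prime] {F : Type*} [Field F] [Fintype F]
    [Algebra (ZMod p) F] {m : ℕ} {f : F → ZMod p}
    (e : F ≃ₗ[ZMod p] (Fin m → ZMod p) × (Fin m → ZMod p))
    (π : Equiv.Perm (Fin m → ZMod p)) (g : (Fin m → ZMod p) → ZMod p)
    (hf : ∀ x, f x = maioranaMcFarland π g (e x)) (b : F) :
    ∃ c : ZMod p, walsh f b = (p : ℂ) ^ m * ZMod.stdAddChar c := by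
  classical
  let ψ : (Fin m → ZMod p) × (Fin m → ZMod p) →ₗ[ZMod p] ZMod p :=
    Algebra.trace (ZMod p) F ∘ₗ LinearMap.mulLeft (ZMod p) b ∘ₗ e.symm.toLinearMap
  let u : Fin m → ZMod p := fun i => ψ (Pi.single i 1, 0)
  have hu (z : Fin m → ZMod p) : ψ (z, 0) = z ⬝ᵥ u := by
    have := LinearMap.pi_apply_eq_sum_univ (ψ ∘ₗ LinearMap.inl (ZMod p) _ _) z
    simp only [LinearMap.comp_apply, LinearMap.inl_apply, smul_eq_mul] at this
    rw [this]
    refine Finset.sum_congr rfl fun i _ => ?_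
    congr 3
    ext j
    simp [Pi.single_apply, eq_comm]
  have key (z₁ z₂ : Fin m → ZMod p) :
      maioranaMcFarland π g (z₁, z₂) - ψ (z₁, z₂) =
        z₁ ⬝ᵥ (π z₂ - u) + (g z₂ - ψ (0, z₂)) := by
    have : ψ (z₁, z₂) = ψ (z₁, 0) + ψ (0, z₂) := by rw [← map_add]; simp
    rw [this, hu, dotProduct_sub, maioranaMcFarland]
    ring
  refine ⟨g (π.symm u) - ψ (0, π.symm u), ?_⟩
  have h1 : walsh f b = ∑ z, (ZMod.stdAddChar (maioranaMcFarland π g z - ψ z) : ℂ) := by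
    rw [walsh, ← e.symm.toEquiv.sum_comp]
    simp [hf, ψ]
  rw [h1, Fintype.sum_prod_type_right]
  simp only [key, AddChar.map_add_eq_mul, ← Finset.sum_mul, sum_stdAddChar_dotProduct, sub_eq_zero]
  rw [Finset.sum_eq_single (π.symm u)]
  · simp
  · intro y _ hy
    rw [if_neg (fun h => hy (by simp [← h])), zero_mul]
  · simp

lemma isRegularBent_of_maioranaMcFarland {p : ℕ} [Fact p.Prime] {F : Type*} [Field F] [Fintype F]
    [Algebra (ZMod p) F] {m : ℕ} {f : F → ZMod p}
    (e : F ≃ₗ[ZMod p] (Fin m → ZMod p) × (Fin m → ZMod p))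
    (π : Equiv.Perm (Fin m → ZMod p)) (g : (Fin m → ZMod p) → ZMod p)
    (hf : ∀ x, f x = maioranaMcFarland π g (e x)) : IsRegularBent f := by
  have hp : (0 : ℝ) < p := by exact_mod_cast (Fact.out : p.Prime).pos
  have hn : Module.finrank (ZMod p) F = 2 * m := by
    rw [e.finrank_eq]; simp [two_mul]
  choose c hc using exists_walsh_eq_of_maioranaMcFarland e π g hf
  refine ⟨fun b => ?_, c, fun b => ?_⟩
  · rw [hc, norm_mul, AddChar.norm_apply, hn]
    simp [pow_mul, mul_comm 2 m]
  · rw [hc, hn, ← mul_assoc]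
    have : (p : ℝ) ^ (-((2 * m : ℕ) : ℝ) / 2) * (p : ℝ) ^ m = 1 := by
      rw [← Real.rpow_natCast, ← Real.rpow_add hp]
      push_cast
      rw [show -(2 * (m : ℝ)) / 2 + m = 0 by ring, Real.rpow_zero]
    have h2 : (((p : ℝ) ^ (-((2 * m : ℕ) : ℝ) / 2) : ℝ) : ℂ) * (p : ℂ) ^ m = 1 := by
      exact_mod_cast congrArg ((↑) : ℝ → ℂ) this
    rw [h2, one_mul]

lemma inCompletedMaioranaMcFarland_of_linearEquiv {p : ℕ} [Fact p.Prime] {E : Type*}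
    [AddCommGroup E] [Module (ZMod p) E] {m : ℕ} {f : E → ZMod p}
    (e : E ≃ₗ[ZMod p] (Fin m → ZMod p) × (Fin m → ZMod p))
    (π : Equiv.Perm (Fin m → ZMod p)) (g : (Fin m → ZMod p) → ZMod p)
    (hf : ∀ x, f x = maioranaMcFarland π g (e x)) : InCompletedMaioranaMcFarland f :=
  ⟨m, π, g, e.toAffineEquiv, 0, 1, one_ne_zero, fun x => by simp [hf]⟩

/-! ### Algebraic degree -/

/-- Over `𝔽_p`, every polynomial agrees as a function with a reduced one of no larger degree: a
positive exponent `a` is replaced by its representative modulo `p - 1` in `1, …, p - 1`. -/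
lemma MvPolynomial.exists_mem_restrictDegree_totalDegree_le {p : ℕ} [Fact p.Prime] {τ : Type*}
    (Q : MvPolynomial τ (ZMod p)) :
    ∃ P ∈ restrictDegree τ (ZMod p) (p - 1), P.totalDegree ≤ Q.totalDegree ∧
      ∀ x, eval x P = eval x Q := by
  classical
  have hp := (Fact.out : p.Prime).two_le
  let r : ℕ → ℕ := fun a => if a = 0 then 0 else (a - 1) % (p - 1) + 1
  have hr0 : r 0 = 0 := rfl
  have hrp (a) : r a ≤ p - 1 := by
    by_cases ha : a = 0
    · simp [r, ha]
    · have := Nat.mod_lt (a - 1) (show 0 < p - 1 by omega)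
      simp only [r, ha, if_false]; omega
  have hra (a) : r a ≤ a := by
    by_cases ha : a = 0
    · simp [r, ha]
    · have := Nat.mod_le (a - 1) (p - 1)
      simp only [r, ha, if_false]; omega
  have hrx (a) (x : ZMod p) : x ^ r a = x ^ a := by
    by_cases ha : a = 0
    · simp [r, ha]
    by_cases hx : x = 0
    · simp [r, ha, hx]
    obtain ⟨a, rfl⟩ := Nat.exists_eq_succ_of_ne_zero ha
    simp only [r, ha, if_false, Nat.succ_eq_add_one, Nat.add_sub_cancel, pow_succ]
    conv_rhs => rw [← Nat.div_add_mod a (p - 1), pow_add, pow_mul, ZMod.pow_card_sub_one_eq_one hx]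
    simp
  let red : (τ →₀ ℕ) → (τ →₀ ℕ) := fun s => s.mapRange r hr0
  refine ⟨∑ s ∈ Q.support, monomial (red s) (Q.coeff s), ?_, ?_, fun x => ?_⟩
  · refine Submodule.sum_mem _ fun s _ => ?_
    rw [mem_restrictDegree]
    intro t ht i
    rw [Finset.mem_singleton.mp (support_monomial_subset ht)]
    exact hrp _
  · refine totalDegree_finsetSum_le fun s hs => (totalDegree_monomial_le _ _).trans
      (le_trans ?_ (le_totalDegree hs))
    rw [Finsupp.sum_of_support_subset _ Finsupp.support_mapRange _ (fun _ _ => rfl), Finsupp.sum]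
    exact Finset.sum_le_sum fun i _ => hra _
  · rw [map_sum, eval_eq]
    refine Finset.sum_congr rfl fun s _ => ?_
    rw [eval_monomial,
      Finsupp.prod_of_support_subset _ Finsupp.support_mapRange _ (fun _ _ => pow_zero _)]
    simp [hrx]

lemma MvPolynomial.totalDegree_aeval_le_of_le_one {R σ τ : Type*} [CommSemiring R]
    {ℓ : σ → MvPolynomial τ R} (hℓ : ∀ i, (ℓ i).totalDegree ≤ 1) (P : MvPolynomial σ R) :
    (aeval ℓ P).totalDegree ≤ P.totalDegree := by
  rw [aeval_def, eval₂_eq]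
  refine totalDegree_finsetSum_le fun s hs => ?_
  refine (totalDegree_mul _ _).trans ?_
  rw [algebraMap_eq, totalDegree_C, zero_add]
  refine (totalDegree_finsetProd _ _).trans (le_trans ?_ (le_totalDegree hs))
  refine Finset.sum_le_sum fun i _ => (totalDegree_pow _ _).trans ?_
  simpa using Nat.mul_le_mul_left (s i) (hℓ i)

/-- A form `x ↦ M(x, …, x)` in `d` arguments is a polynomial of degree at most `d` in the
coordinates of any basis. -/
lemma MultilinearMap.exists_mvPolynomial_totalDegree_le {R E ι : Type*} [CommRing R]
    [AddCommGroup E] [Module R E] [Fintype ι] {d : ℕ}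
    (M : MultilinearMap R (fun _ : Fin d => E) R) (B : Module.Basis ι R E) :
    ∃ Q : MvPolynomial ι R, Q.totalDegree ≤ d ∧
      ∀ x, M (fun _ => x) = MvPolynomial.eval (fun i => B.repr x i) Q := by
  classical
  refine ⟨∑ r : Fin d → ι, C (M fun j => B (r j)) * ∏ j, X (r j), ?_, fun x => ?_⟩
  · refine totalDegree_finsetSum_le fun r _ => (totalDegree_mul _ _).trans ?_
    rw [totalDegree_C, zero_add]
    refine (totalDegree_finsetProd _ _).trans ?_
    refine (Finset.sum_le_card_nsmul _ _ 1 fun j _ => ?_).trans (by simp)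
    rw [X]
    exact (totalDegree_monomial_le _ _).trans (by simp)
  · conv_lhs => rw [← B.sum_repr x]
    rw [M.map_sum]
    simp [M.map_smul_univ, mul_comm]

/-- The Chevalley–Warning summation principle on a subspace: a function of degree `deg P`,
restricted to the span of `v` and multiplied by a polynomial `R`, sums to zero over the coefficients
as long as `deg P + deg R` stays below `(p - 1) |ι|`. -/
lemma sum_eval_mul_comp_eq_zero {p : ℕ} [Fact p.Prime] {E τ ι : Type*} [AddCommGroup E]
    [Module (ZMod p) E] [Fintype ι] [DecidableEq ι] [Fintype τ] {f : E → ZMod p}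
    (B : Module.Basis τ (ZMod p) E)
    {P : MvPolynomial τ (ZMod p)} (hf : ∀ x, f x = eval (fun i => B.repr x i) P)
    (R : MvPolynomial ι (ZMod p)) (v : ι → E)
    (hdeg : P.totalDegree + R.totalDegree < (p - 1) * Fintype.card ι) :
    ∑ c : ι → ZMod p, eval c R * f (∑ i, c i • v i) = 0 := by
  let ℓ : τ → MvPolynomial ι (ZMod p) := fun t => ∑ i, C (B.repr (v i) t) * X i
  have hℓ (t) : (ℓ t).totalDegree ≤ 1 := by
    refine totalDegree_finsetSum_le fun i _ => (totalDegree_mul _ _).trans ?_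
    rw [totalDegree_C, zero_add, totalDegree_X]
  have h := MvPolynomial.sum_eval_eq_zero (R * aeval ℓ P) (by
    rw [ZMod.card]
    have h1 := totalDegree_mul R (aeval ℓ P)
    have h2 := MvPolynomial.totalDegree_aeval_le_of_le_one hℓ P
    omega)
  rw [← h]
  refine Finset.sum_congr rfl fun c _ => ?_
  rw [map_mul, hf]
  congr 1
  rw [← coe_aeval_eq_eval c, ← coe_aeval_eq_eval]
  simp only [RingHom.coe_coe]
  rw [← AlgHom.comp_apply, comp_aeval]
  congr 2
  ext t
  simp [ℓ, mul_comm]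

/-! ### The splitting of the field by a twisted involution -/

lemma three_eq_zero_of_algebra_zmod (F : Type*) [Field F] [Algebra (ZMod 3) F] : (3 : F) = 0 := by
  have h := congrArg (algebraMap (ZMod 3) F) (show (3 : ZMod 3) = 0 from rfl)
  rwa [map_ofNat, map_zero] at h

/-- The elements `x` with `κ * σ x = x`, an `𝔽₃`-subspace of `F`. -/
def twistedFixed {F : Type*} [Field F] [Algebra (ZMod 3) F] (σ : F ≃ₐ[ZMod 3] F) (κ : F) :
    Submodule (ZMod 3) F where
  carrier := {x | κ * σ x = x}
  zero_mem' := by simp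
  add_mem' {x y} hx hy := by
    simp only [Set.mem_ofPred_eq] at hx hy ⊢
    rw [map_add, mul_add, hx, hy]
  smul_mem' c x hx := by
    simp only [Set.mem_ofPred_eq] at hx ⊢
    rw [map_smul, mul_smul_comm, hx]

section twisted

variable {F : Type*} [Field F] [Algebra (ZMod 3) F] {σ : F ≃ₐ[ZMod 3] F} {κ : F}

lemma mem_twistedFixed {x : F} : x ∈ twistedFixed σ κ ↔ κ * σ x = x := Iff.rfl

lemma add_mul_apply_mem_twistedFixed (hσ : ∀ x, σ (σ x) = x) (hκ : κ * σ κ = 1) (x : F) :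
    x + κ * σ x ∈ twistedFixed σ κ := by
  rw [mem_twistedFixed, map_add, map_mul, hσ]
  linear_combination x * hκ

lemma sub_mul_apply_mem_twistedFixed (hσ : ∀ x, σ (σ x) = x) (hκ : κ * σ κ = 1) (x : F) :
    x - κ * σ x ∈ twistedFixed σ (-κ) := by
  rw [mem_twistedFixed, map_sub, map_mul, hσ]
  linear_combination x * hκ

/-- Since `x ↦ κ * σ x` is an involution, `F` is the direct sum of its eigenspaces for `-1` and `1`;
in characteristic three, `x = -((x - κ * σ x) + (x + κ * σ x))`. -/
def twistedSplit (hσ : ∀ x, σ (σ x) = x) (hκ : κ * σ κ = 1) :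
    F ≃ₗ[ZMod 3] twistedFixed σ (-κ) × twistedFixed σ κ where
  toFun x := (⟨x - κ * σ x, sub_mul_apply_mem_twistedFixed hσ hκ x⟩,
    ⟨x + κ * σ x, add_mul_apply_mem_twistedFixed hσ hκ x⟩)
  map_add' x y := by
    ext <;> simp <;> ring
  map_smul' c x := by
    ext <;> simp [smul_sub]
  invFun z := -(z.1 + z.2 : F)
  left_inv x := by
    dsimp only
    linear_combination -x * three_eq_zero_of_algebra_zmod F
  right_inv := by
    rintro ⟨⟨d, hd⟩, ⟨s, hs⟩⟩
    rw [mem_twistedFixed] at hd hs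
    have h3 := three_eq_zero_of_algebra_zmod F
    ext
    · simp only [map_neg, map_add]
      linear_combination -hd + hs - d * h3
    · simp only [map_neg, map_add]
      linear_combination hd - hs - s * h3

/-- Multiplication by an element `μ` with `σ μ = -μ` exchanges the two eigenspaces. -/
lemma finrank_twistedFixed_neg_le [Finite F] (hσ : ∀ x, σ (σ x) = x) (hσ1 : ∃ x, σ x ≠ x) (κ : F) :
    Module.finrank (ZMod 3) (twistedFixed σ κ) ≤ Module.finrank (ZMod 3) (twistedFixed σ (-κ)) := by
  obtain ⟨x, hx⟩ := hσ1
  have hμ : x - σ x ≠ 0 := sub_ne_zero.mpr (Ne.symm hx)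
  have hσμ : σ (x - σ x) = -(x - σ x) := by rw [map_sub, hσ]; ring
  let φ : twistedFixed σ κ →ₗ[ZMod 3] twistedFixed σ (-κ) :=
    ((LinearMap.mulLeft (ZMod 3) (x - σ x)).comp (twistedFixed σ κ).subtype).codRestrict _ (by
      rintro ⟨y, hy⟩
      rw [mem_twistedFixed] at hy
      rw [mem_twistedFixed]
      simp only [LinearMap.comp_apply, Submodule.subtype_apply, LinearMap.mulLeft_apply, map_mul,
        hσμ]
      linear_combination (x - σ x) * hy)
  refine LinearMap.finrank_le_finrank_of_injective (f := φ) fun y z h => ?_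
  have h1 : (x - σ x) * (y : F) = (x - σ x) * z := congrArg Subtype.val h
  exact Subtype.ext (mul_left_cancel₀ hμ h1)

lemma finrank_twistedFixed [Finite F] (hσ : ∀ x, σ (σ x) = x) (hσ1 : ∃ x, σ x ≠ x)
    (hκ : κ * σ κ = 1) {k : ℕ} (hF : Module.finrank (ZMod 3) F = 2 * k) :
    Module.finrank (ZMod 3) (twistedFixed σ κ) = k := by
  have h1 := finrank_twistedFixed_neg_le hσ hσ1 κ
  have h2 := finrank_twistedFixed_neg_le hσ hσ1 (-κ)
  rw [neg_neg] at h2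
  have h3 := (twistedSplit hσ hκ).finrank_eq
  rw [Module.finrank_prod, hF] at h3
  omega

lemma exists_mem_twistedFixed_ne_zero [Finite F] (hσ : ∀ x, σ (σ x) = x) (hσ1 : ∃ x, σ x ≠ x)
    (hκ : κ * σ κ = 1) {k : ℕ} (hF : Module.finrank (ZMod 3) F = 2 * k) (hk : 1 < k) :
    ∃ x ∈ twistedFixed σ κ, x ≠ 0 := by
  refine (Submodule.ne_bot_iff _).mp fun h => ?_
  have := finrank_twistedFixed hσ hσ1 hκ hF
  rw [h, finrank_bot] at this
  omega

/-- The fixed field of `σ` has `3 ^ k` elements, and at most three of them are roots of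
`t ^ 3 - t`. -/
lemma exists_apply_eq_self_pow_three_ne [Finite F] (hσ : ∀ x, σ (σ x) = x) (hσ1 : ∃ x, σ x ≠ x)
    {k : ℕ} (hF : Module.finrank (ZMod 3) F = 2 * k) (hk : 1 < k) :
    ∃ t, σ t = t ∧ t ^ 3 ≠ t := by
  classical
  by_contra! h
  have h1 : Nat.card (twistedFixed σ (1 : F)) = 3 ^ k := by
    rw [Module.natCard_eq_pow_finrank (K := ZMod 3), Nat.card_zmod,
      finrank_twistedFixed hσ hσ1 (by simp) hF]
  have h2 : (twistedFixed σ (1 : F) : Set F) ⊆ (({0, 1, -1} : Finset F) : Set F) := by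
    intro t ht
    have h3 := h t (by simpa [mem_twistedFixed] using ht)
    have h4 : t * ((t - 1) * (t + 1)) = 0 := by linear_combination h3
    simpa [sub_eq_zero, add_eq_zero_iff_eq_neg] using h4
  have h3 := Set.ncard_le_ncard h2 (Finset.finite_toSet _)
  rw [Set.ncard_coe_finset] at h3
  have h4 : (twistedFixed σ (1 : F) : Set F).ncard = 3 ^ k := h1
  have h5 : ({0, 1, -1} : Finset F).card ≤ 3 := Finset.card_le_three
  have h6 : 3 ^ 1 < 3 ^ k := Nat.pow_lt_pow_right (by norm_num) hk
  omega

/-- If `σ w = -κ w`, then `Tr (w (y - κ σ y)) = 2 Tr (w y)`, so that `w` is determined by the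
functional it induces on the `-1`-eigenspace. -/
lemma eq_zero_of_forall_trace_mul_eq_zero [Finite F] (hσ : ∀ x, σ (σ x) = x) (hκ : κ * σ κ = 1)
    {w : F} (hw : σ w = -κ * w)
    (h : ∀ d ∈ twistedFixed σ (-κ), Algebra.trace (ZMod 3) F (w * d) = 0) : w = 0 := by
  by_contra hw0
  have key (y : F) : Algebra.trace (ZMod 3) F (w * y) = 0 := by
    have h1 := h _ (sub_mul_apply_mem_twistedFixed hσ hκ y)
    have h2 : w * (y - κ * σ y) = w * y + σ (w * y) := by
      rw [map_mul, hw]; ring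
    rw [h2, map_add, Algebra.trace_eq_of_algEquiv] at h1
    generalize Algebra.trace (ZMod 3) F (w * y) = a at h1 ⊢
    revert a; decide
  refine Algebra.trace_ne_zero (ZMod 3) F (LinearMap.ext fun z => ?_)
  have := key (w⁻¹ * z)
  rwa [mul_inv_cancel_left₀ hw0] at this

/-! ### The trinomial in split coordinates -/

variable {α : F}

lemma apply_pow_five_mul (hα : σ α = -κ ^ 2 * α) {s : F} (hs : s ∈ twistedFixed σ κ) :
    σ (α ^ 3 * s ^ 5) = -κ * (α ^ 3 * s ^ 5) := by
  rw [mem_twistedFixed] at hs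
  rw [map_mul, map_pow, map_pow, hα]
  conv_rhs => rw [← hs]
  ring

lemma trace_pow_three [Finite F] (x : F) :
    Algebra.trace (ZMod 3) F (x ^ 3) = Algebra.trace (ZMod 3) F x := by
  rw [← Algebra.trace_eq_of_algEquiv (FiniteField.frobeniusAlgEquivOfAlgebraic (ZMod 3) F) x]
  simp

/-- With `s = x + κ σ x` and `d = x - κ σ x`, the sum of the argument of the trace and its conjugate
is `α³ s⁵ d - (α s d)³ + α s d`; the last two terms have opposite traces. -/
lemma trace_trinomial_eq [Finite F] (hσ : ∀ x, σ (σ x) = x) (hκ : κ * σ κ = 1)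
    (hα : σ α = -κ ^ 2 * α) (x : F) :
    Algebra.trace (ZMod 3) F
        (α ^ 2 * σ α * (x ^ 4 * σ x ^ 2) + κ * α ^ 3 * (x ^ 5 * σ x) + α * x ^ 2) =
      -Algebra.trace (ZMod 3) F (α ^ 3 * (x + κ * σ x) ^ 5 * (x - κ * σ x)) := by
  set A := α ^ 2 * σ α * (x ^ 4 * σ x ^ 2) + κ * α ^ 3 * (x ^ 5 * σ x) + α * x ^ 2 with hA
  set s := x + κ * σ x with hs
  set d := x - κ * σ x with hd
  have hσA : A + σ A = α ^ 3 * s ^ 5 * d - (α * s * d) ^ 3 + α * s * d := by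
    have h1 : σ A = σ α ^ 2 * α * (σ x ^ 4 * x ^ 2) + σ κ * σ α ^ 3 * (σ x ^ 5 * x)
        + σ α * σ x ^ 2 := by
      simp only [hA, map_add, map_mul, map_pow, hσ]
    have h2 : σ κ * σ α ^ 3 = -κ ^ 5 * α ^ 3 := by
      rw [hα]; linear_combination (-κ ^ 5 * α ^ 3) * hκ
    rw [h1, h2, hA, hα, hs, hd]
    linear_combination (-α ^ 3 * (x * (κ * σ x)) * (x ^ 2 - (κ * σ x) ^ 2) *
      ((x + κ * σ x) ^ 2 + x * (κ * σ x))) *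
      three_eq_zero_of_algebra_zmod F
  clear_value A
  have h := congrArg (Algebra.trace (ZMod 3) F) hσA
  rw [map_add, map_add, map_sub, Algebra.trace_eq_of_algEquiv, trace_pow_three] at h
  generalize Algebra.trace (ZMod 3) F A = a at h ⊢
  have h3 : (3 : ZMod 3) = 0 := rfl
  linear_combination -h + a * h3

/-- The quintic map `s ↦ Tr (α³ s⁵ ·)` from the `1`-eigenspace to the dual of the `-1`-eigenspace is
injective as soon as the fixed field of `σ` has no nontrivial fifth root of unity. -/
lemma eq_of_forall_trace_pow_five_eq [Finite F] (hσ : ∀ x, σ (σ x) = x) (hκ : κ * σ κ = 1)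
    (hα0 : α ≠ 0) (hα : σ α = -κ ^ 2 * α) (h5 : ∀ t, σ t = t → t ^ 5 = 1 → t = 1) {s t : F}
    (hs : s ∈ twistedFixed σ κ) (ht : t ∈ twistedFixed σ κ)
    (h : ∀ d ∈ twistedFixed σ (-κ), Algebra.trace (ZMod 3) F (α ^ 3 * s ^ 5 * d) =
      Algebra.trace (ZMod 3) F (α ^ 3 * t ^ 5 * d)) : s = t := by
  have h0 : α ^ 3 * s ^ 5 - α ^ 3 * t ^ 5 = 0 := by
    refine eq_zero_of_forall_trace_mul_eq_zero hσ hκ ?_ fun d hd => ?_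
    · rw [map_sub, apply_pow_five_mul hα hs, apply_pow_five_mul hα ht]; ring
    · rw [sub_mul, map_sub, h d hd, sub_self]
  have h1 : s ^ 5 = t ^ 5 := mul_left_cancel₀ (pow_ne_zero 3 hα0) (sub_eq_zero.mp h0)
  by_cases ht0 : t = 0
  · subst ht0
    simpa using h1
  have hκ0 : κ ≠ 0 := left_ne_zero_of_mul_eq_one hκ
  rw [mem_twistedFixed] at hs ht
  refine (div_eq_one_iff_eq ht0).mp (h5 _ ?_ ?_)
  · rw [map_div₀]
    conv_rhs => rw [← hs, ← ht, mul_div_mul_left _ _ hκ0]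
  · rw [div_pow, h1, div_self (pow_ne_zero 5 ht0)]

/-- In bases of the two eigenspaces, `-Tr (α³ s⁵ d)` is a Maiorana–McFarland function, linear
in `d`. -/
lemma exists_maioranaMcFarland_eq [Finite F] (hσ : ∀ x, σ (σ x) = x) (hσ1 : ∃ x, σ x ≠ x)
    (hκ : κ * σ κ = 1) (hα0 : α ≠ 0) (hα : σ α = -κ ^ 2 * α)
    (h5 : ∀ t, σ t = t → t ^ 5 = 1 → t = 1) {k : ℕ} (hF : Module.finrank (ZMod 3) F = 2 * k) :
    ∃ (e : F ≃ₗ[ZMod 3] (Fin k → ZMod 3) × (Fin k → ZMod 3))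
      (π : Equiv.Perm (Fin k → ZMod 3)),
      ∀ x, -Algebra.trace (ZMod 3) F (α ^ 3 * (x + κ * σ x) ^ 5 * (x - κ * σ x)) =
        maioranaMcFarland π 0 (e x) := by
  have hκ' : -κ * σ (-κ) = 1 := by rw [map_neg, neg_mul_neg, hκ]
  let bS := Module.finBasisOfFinrankEq (ZMod 3) _ (finrank_twistedFixed hσ hσ1 hκ hF)
  let bD := Module.finBasisOfFinrankEq (ZMod 3) _ (finrank_twistedFixed hσ hσ1 hκ' hF)
  let π₀ : (Fin k → ZMod 3) → (Fin k → ZMod 3) := fun y i =>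
    -Algebra.trace (ZMod 3) F (α ^ 3 * (bS.equivFun.symm y : F) ^ 5 * bD i)
  have hπ₀ (y : Fin k → ZMod 3) (d : twistedFixed σ (-κ)) : bD.equivFun d ⬝ᵥ π₀ y =
      -Algebra.trace (ZMod 3) F (α ^ 3 * (bS.equivFun.symm y : F) ^ 5 * d) := by
    conv_rhs => rw [← bD.sum_equivFun d]
    simp only [dotProduct, π₀, mul_neg, Finset.sum_neg_distrib, Submodule.coe_sum,
      Submodule.coe_smul, Finset.mul_sum, mul_smul_comm, map_sum, map_smul, smul_eq_mul]
  have hinj : Function.Injective π₀ := by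
    intro y z hyz
    refine bS.equivFun.symm.injective (Subtype.ext ?_)
    refine eq_of_forall_trace_pow_five_eq hσ hκ hα0 hα h5 (Subtype.coe_prop _)
      (Subtype.coe_prop _) fun d hd => neg_injective ?_
    rw [← hπ₀ y ⟨d, hd⟩, ← hπ₀ z ⟨d, hd⟩, hyz]
  refine ⟨(twistedSplit hσ hκ).trans (bD.equivFun.prodCongr bS.equivFun),
    Equiv.ofBijective π₀ (Finite.injective_iff_bijective.mp hinj), fun x => ?_⟩
  have h := hπ₀ (bS.equivFun (twistedSplit hσ hκ x).2) (twistedSplit hσ hκ x).1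
  rw [LinearEquiv.symm_apply_apply] at h
  change _ = bD.equivFun _ ⬝ᵥ π₀ (bS.equivFun _) + 0
  rw [add_zero]
  exact h.symm

end twisted

/-! ### The algebraic degree of the trinomial -/

section degree

variable {F : Type*} [Field F] [Algebra (ZMod 3) F] {σ : F ≃ₐ[ZMod 3] F} {κ : F} {α : F}

/-- The quintic `s⁵ = s³ · s · s` is a product of three linear maps, so `-Tr (α³ s⁵ d)` is a form
in four arguments. -/
lemma exists_multilinearMap_eq [Finite F] (σ : F ≃ₐ[ZMod 3] F) (κ α : F) :
    ∃ M : MultilinearMap (ZMod 3) (fun _ : Fin 4 => F) (ZMod 3),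
      ∀ x, M (fun _ => x) =
        -Algebra.trace (ZMod 3) F (α ^ 3 * (x + κ * σ x) ^ 5 * (x - κ * σ x)) := by
  let T : F →ₗ[ZMod 3] F := LinearMap.mulLeft (ZMod 3) κ ∘ₗ σ.toLinearMap
  let S : F →ₗ[ZMod 3] F := LinearMap.id + T
  let D : F →ₗ[ZMod 3] F := LinearMap.id - T
  let φ : F →ₗ[ZMod 3] F := (FiniteField.frobeniusAlgHom (ZMod 3) F).toLinearMap
  refine ⟨(-(Algebra.trace (ZMod 3) F ∘ₗ LinearMap.mulLeft (ZMod 3) (α ^ 3))).compMultilinearMap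
    ((MultilinearMap.mkPiAlgebra (ZMod 3) (Fin 4) F).compLinearMap ![φ ∘ₗ S, S, S, D]),
    fun x => ?_⟩
  simp [Fin.prod_univ_succ, S, D, T, φ]
  congr 1
  ring

/-- On the span of `γ`, `t γ` and `δ`, the coefficient of `c₀² c₁ c₂` in `-Tr (α³ s⁵ d)` is
`-Tr (α³ γ⁵ (t³ - t) δ)`. It is recovered by summing against `c₁ c₂`, which would give zero if the
degree were at most three. -/
lemma four_le_totalDegree_of_eval_eq [Finite F] (hσ : ∀ x, σ (σ x) = x) (hσ1 : ∃ x, σ x ≠ x)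
    (hκ : κ * σ κ = 1) (hα0 : α ≠ 0) (hα : σ α = -κ ^ 2 * α) {k : ℕ}
    (hF : Module.finrank (ZMod 3) F = 2 * k) (hk : 1 < k)
    {τ : Type*} [Fintype τ] (B : Module.Basis τ (ZMod 3) F) {P : MvPolynomial τ (ZMod 3)}
    (hP : ∀ x, -Algebra.trace (ZMod 3) F (α ^ 3 * (x + κ * σ x) ^ 5 * (x - κ * σ x)) =
      eval (fun i => B.repr x i) P) : 4 ≤ P.totalDegree := by
  by_contra! hdeg
  have h3 := three_eq_zero_of_algebra_zmod F
  obtain ⟨t, ht, ht3⟩ := exists_apply_eq_self_pow_three_ne hσ hσ1 hF hk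
  obtain ⟨γ, hγ, hγ0⟩ := exists_mem_twistedFixed_ne_zero hσ hσ1 hκ hF hk
  have hw : σ (α ^ 3 * γ ^ 5 * (t ^ 3 - t)) = -κ * (α ^ 3 * γ ^ 5 * (t ^ 3 - t)) := by
    rw [map_mul, apply_pow_five_mul hα hγ, map_sub, map_pow, ht, mul_assoc]
  obtain ⟨δ, hδ, hδ0⟩ : ∃ δ ∈ twistedFixed σ (-κ),
      Algebra.trace (ZMod 3) F (α ^ 3 * γ ^ 5 * (t ^ 3 - t) * δ) ≠ 0 := by
    by_contra! h
    exact mul_ne_zero (mul_ne_zero (pow_ne_zero 3 hα0) (pow_ne_zero 5 hγ0)) (sub_ne_zero.mpr ht3)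
      (eq_zero_of_forall_trace_mul_eq_zero hσ hκ hw h)
  rw [mem_twistedFixed] at hγ hδ
  have hδ' : κ * σ δ = -δ := by linear_combination -hδ
  let tr (y : F) : ZMod 3 := Algebra.trace (ZMod 3) F (α ^ 3 * γ ^ 5 * y * δ)
  have hf (c : Fin 3 → ZMod 3) (x : F) (hx : x = ∑ i, c i • ![γ, t * γ, δ] i) :
      -Algebra.trace (ZMod 3) F (α ^ 3 * (x + κ * σ x) ^ 5 * (x - κ * σ x)) =
        -(c 2 * (c 0 * tr 1 + c 0 ^ 2 * c 1 * tr (t ^ 3 - t)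
          + c 0 * c 1 ^ 2 * tr (t ^ 2 + 2 * t ^ 4) + c 1 * tr (t ^ 5))) := by
    have hx' : x = c 0 • γ + c 1 • (t * γ) + c 2 • δ := by simp [hx, Fin.sum_univ_three]
    have hσx : κ * σ x = c 0 • γ + c 1 • (t * γ) - c 2 • δ := by
      rw [hx']
      simp only [map_add, map_smul, map_mul, ht, mul_add, mul_smul_comm, mul_left_comm κ t, hγ, hδ']
      rw [smul_neg, sub_eq_add_neg]
    have e0 (a : ZMod 3) : algebraMap (ZMod 3) F a ^ 3 = algebraMap (ZMod 3) F a := by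
      rw [← map_pow, ZMod.pow_card]
    have key : α ^ 3 * (x + κ * σ x) ^ 5 * (x - κ * σ x) =
        c 2 • (c 0 • (α ^ 3 * γ ^ 5 * 1 * δ) + (c 0 ^ 2 * c 1) • (α ^ 3 * γ ^ 5 * (t ^ 3 - t) * δ)
          + (c 0 * c 1 ^ 2) • (α ^ 3 * γ ^ 5 * (t ^ 2 + 2 * t ^ 4) * δ)
          + c 1 • (α ^ 3 * γ ^ 5 * t ^ 5 * δ)) := by
      have hs : x + κ * σ x =
          -((algebraMap (ZMod 3) F (c 0) + algebraMap (ZMod 3) F (c 1) * t) * γ) := by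
        rw [hσx, hx']; simp only [Algebra.smul_def]
        linear_combination
          ((algebraMap (ZMod 3) F (c 0) + algebraMap (ZMod 3) F (c 1) * t) * γ) * h3
      have hd : x - κ * σ x = -(algebraMap (ZMod 3) F (c 2) * δ) := by
        rw [hσx, hx']; simp only [Algebra.smul_def]
        linear_combination (algebraMap (ZMod 3) F (c 2) * δ) * h3
      rw [hs, hd]
      simp only [Algebra.smul_def, map_mul, map_pow]
      have h0 := e0 (c 0)
      have h1 := e0 (c 1)
      generalize algebraMap (ZMod 3) F (c 0) = a at *
      generalize algebraMap (ZMod 3) F (c 1) = b at *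
      generalize algebraMap (ZMod 3) F (c 2) = e at *
      have hcube : (a + b * t) ^ 3 = a + b * t ^ 3 := by
        linear_combination h0 + t ^ 3 * h1 + (a ^ 2 * b * t + a * b ^ 2 * t ^ 2) * h3
      have hfive : (a + b * t) ^ 5 = a + a ^ 2 * b * (t ^ 3 - t) + a * b ^ 2 * (t ^ 2 + 2 * t ^ 4)
          + b * t ^ 5 := by
        rw [show (a + b * t) ^ 5 = (a + b * t) ^ 3 * (a + b * t) ^ 2 by ring, hcube]
        linear_combination h0 + t ^ 5 * h1 + a ^ 2 * b * t * h3
      linear_combination (α ^ 3 * γ ^ 5 * e * δ) * hfive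
    rw [key]
    simp only [map_smul, map_add, smul_eq_mul, tr]
  have hsum := sum_eval_mul_comp_eq_zero B hP (X 1 * X 2 : MvPolynomial (Fin 3) (ZMod 3))
    ![γ, t * γ, δ] (by
      have := totalDegree_mul (X 1 : MvPolynomial (Fin 3) (ZMod 3)) (X 2)
      rw [totalDegree_X, totalDegree_X] at this
      simp only [Fintype.card_fin]
      omega)
  simp only [hf _ _ rfl, map_mul, eval_X] at hsum
  -- Over `𝔽₃`, a monomial sums to zero unless each of its variables has a positive even exponent.
  have hcoeff (a₀ a₁ a₂ a₃ : ZMod 3) : ∑ c : Fin 3 → ZMod 3, c 1 * c 2 *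
      -(c 2 * (c 0 * a₀ + c 0 ^ 2 * c 1 * a₁ + c 0 * c 1 ^ 2 * a₂ + c 1 * a₃)) = a₁ := by
    have h : ∀ c : Fin 3 → ZMod 3, c 1 * c 2 *
      -(c 2 * (c 0 * a₀ + c 0 ^ 2 * c 1 * a₁ + c 0 * c 1 ^ 2 * a₂ + c 1 * a₃)) =
        -(c 0 * c 1 * c 2 ^ 2) * a₀ + -(c 0 ^ 2 * c 1 ^ 2 * c 2 ^ 2) * a₁
          + -(c 0 * c 1 ^ 3 * c 2 ^ 2) * a₂ + -(c 1 ^ 2 * c 2 ^ 2) * a₃ := fun c => by ring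
    simp only [h, Finset.sum_add_distrib, ← Finset.sum_mul]
    have s₀ : ∑ c : Fin 3 → ZMod 3, -(c 0 * c 1 * c 2 ^ 2) = 0 := by decide
    have s₁ : ∑ c : Fin 3 → ZMod 3, -(c 0 ^ 2 * c 1 ^ 2 * c 2 ^ 2) = 1 := by decide
    have s₂ : ∑ c : Fin 3 → ZMod 3, -(c 0 * c 1 ^ 3 * c 2 ^ 2) = 0 := by decide
    have s₃ : ∑ c : Fin 3 → ZMod 3, -(c 1 ^ 2 * c 2 ^ 2) = 0 := by decide
    rw [s₀, s₁, s₂, s₃]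
    ring
  exact hδ0 ((hcoeff _ _ _ _).symm.trans hsum)

lemma hasAlgebraicDegree_four [Finite F] (hσ : ∀ x, σ (σ x) = x) (hσ1 : ∃ x, σ x ≠ x)
    (hκ : κ * σ κ = 1) (hα0 : α ≠ 0) (hα : σ α = -κ ^ 2 * α) {k : ℕ}
    (hF : Module.finrank (ZMod 3) F = 2 * k) (hk : 1 < k) {f : F → ZMod 3}
    (hf : ∀ x, f x =
      -Algebra.trace (ZMod 3) F (α ^ 3 * (x + κ * σ x) ^ 5 * (x - κ * σ x))) :
    HasAlgebraicDegree f 4 := by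
  intro B
  obtain ⟨M, hM⟩ := exists_multilinearMap_eq σ κ α
  obtain ⟨Q, hQ, hMQ⟩ := M.exists_mvPolynomial_totalDegree_le B
  obtain ⟨P, hP, hPQ, hPe⟩ := MvPolynomial.exists_mem_restrictDegree_totalDegree_le Q
  have hfP (x : F) : f x = eval (fun i => B.repr x i) P := by rw [hPe, ← hMQ, hM, hf]
  refine ⟨P, hP, le_antisymm (hPQ.trans hQ) ?_, hfP⟩
  exact four_le_totalDegree_of_eval_eq hσ hσ1 hκ hα0 hα hF hk B fun x => by rw [← hf, hfP]

end degree

/-! ### The coefficients of the trinomial -/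

lemma coprime_five_three_pow_sub_one {k : ℕ} (hk4 : ¬ 4 ∣ k) : Nat.Coprime 5 (3 ^ k - 1) := by
  rw [Nat.Prime.coprime_iff_not_dvd (by norm_num)]
  intro h
  have h1 : 3 ^ k % 5 = 3 ^ (k % 4) % 5 := by
    conv_lhs => rw [← Nat.div_add_mod k 4, pow_add, pow_mul, Nat.mul_mod, Nat.pow_mod]
    simp
  have h2 : 0 < 3 ^ k := by positivity
  have h3 : k % 4 = 1 ∨ k % 4 = 2 ∨ k % 4 = 3 := by omega
  rcases h3 with h3 | h3 | h3 <;> rw [h3] at h1 <;> norm_num at h1 <;> omega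

lemma IsPrimitiveRoot.sq_eq_neg_one_of_four {R : Type*} [CommRing R] [IsDomain R] {I : R}
    (hI : IsPrimitiveRoot I 4) : I ^ 2 = -1 :=
  (hI.pow (by norm_num) (show 4 = 2 * 2 by norm_num)).eq_neg_one_of_two_right

/-- In both parities of `k` the coefficients have the shape `α² σ(α)`, `κ α³`, `α`, with
`κ σ(κ) = 1` and `σ(α) = -κ² α`: for odd `k`, `α = 1` and `κ = a₂`; for even `k`,
`κ = ∓ I α ^ ((3 ^ k - 1) / 2)`. -/
lemma IsTrinomialCoeff.exists_twist {F : Type*} [Field F] {k : ℕ} (hk : 1 < k) {a₁ a₂ a₃ : F}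
    (ha : IsTrinomialCoeff k a₁ a₂ a₃) :
    ∃ κ α : F, κ * κ ^ 3 ^ k = 1 ∧ α ≠ 0 ∧ α ^ 3 ^ k = -κ ^ 2 * α ∧
      a₁ = α ^ 2 * α ^ 3 ^ k ∧ a₂ = κ * α ^ 3 ∧ a₃ = α := by
  obtain ⟨I, hI, ⟨hodd, rfl, rfl, h2⟩ | ⟨heven, α, hα, rfl, ha₃, h2⟩⟩ := ha
  · have hsq : a₂ ^ 2 = -1 := by
      rcases h2 with rfl | rfl <;> simp [hI.sq_eq_neg_one_of_four]
    refine ⟨a₂, 1, ?_, one_ne_zero, by simp [hsq], by simp, by simp, rfl⟩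
    obtain ⟨j, rfl⟩ := hodd
    have h4 : 3 ^ (2 * j + 1) % 4 = 3 := by
      rw [pow_succ, pow_mul, Nat.mul_mod, Nat.pow_mod]; norm_num
    rw [← pow_succ', ← Nat.div_add_mod (3 ^ (2 * j + 1) + 1) 4,
      show (3 ^ (2 * j + 1) + 1) % 4 = 0 by omega, add_zero,
      show 4 * ((3 ^ (2 * j + 1) + 1) / 4) = 2 * (2 * ((3 ^ (2 * j + 1) + 1) / 4)) by ring,
      pow_mul, hsq]
    simp
  · have h4 : 3 ^ k % 4 = 1 := by
      obtain ⟨j, rfl⟩ := heven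
      rw [← two_mul, pow_mul, Nat.pow_mod]; norm_num
    -- Writing `3 ^ k = 4 r + 1` removes the truncated subtractions and divisions in the exponents.
    obtain ⟨r, hr⟩ : ∃ r, 3 ^ k = 4 * r + 1 := ⟨3 ^ k / 4, by omega⟩
    have hr1 : 1 ≤ r := by
      have : 3 ^ 1 < 3 ^ k := Nat.pow_lt_pow_right (by norm_num) hk
      omega
    have hq : 3 ^ (2 * k) = (4 * r + 1) ^ 2 := by rw [mul_comm, pow_mul, hr]
    have hcard : 3 ^ (2 * k) - 1 = ((2 * r + 1) * (4 * r)) * 2 := by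
      rw [hq]
      have : (4 * r + 1) ^ 2 = ((2 * r + 1) * (4 * r)) * 2 + 1 := by ring
      omega
    rw [hcard] at hα
    have hα0 : α ≠ 0 := hα.ne_zero (by positivity)
    have hhalf : α ^ ((2 * r + 1) * (4 * r)) = -1 :=
      (hα.pow (by positivity) rfl).eq_neg_one_of_two_right
    rw [hr] at h2 ⊢
    obtain ⟨J, hJ, h2⟩ : ∃ J : F, J ^ 2 = -1 ∧
        a₂ = J * ((α ^ (4 * r + 1 + 2)) ^ ((4 * r + 1 - 3) / 2))⁻¹ := by
      rcases h2 with h2 | h2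
      · exact ⟨I, hI.sq_eq_neg_one_of_four, h2⟩
      · exact ⟨-I, by rw [neg_sq, hI.sq_eq_neg_one_of_four], by rw [h2, neg_mul]⟩
    have hinv : ((α ^ (4 * r + 1 + 2)) ^ ((4 * r + 1 - 3) / 2))⁻¹ = -α ^ (2 * r + 3) := by
      refine inv_eq_of_mul_eq_one_right ?_
      obtain ⟨u, rfl⟩ : ∃ u, r = u + 1 := ⟨r - 1, by omega⟩
      rw [show (4 * (u + 1) + 1 - 3) / 2 = 2 * u + 1 by omega, ← pow_mul, mul_neg, ← pow_add,
        show (4 * (u + 1) + 1 + 2) * (2 * u + 1) + (2 * (u + 1) + 3) =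
          (2 * (u + 1) + 1) * (4 * (u + 1)) by ring, hhalf, neg_neg]
    refine ⟨-J * α ^ (2 * r), α, ?_, hα0, ?_, by rw [← pow_add, add_comm 2], ?_, ha₃⟩
    · rw [← pow_succ', show 4 * r + 1 + 1 = 2 * (2 * r + 1) by ring, pow_mul, mul_pow, neg_sq, hJ,
        mul_pow, ← pow_mul, ← pow_mul,
        show 2 * r * (2 * (2 * r + 1)) = (2 * r + 1) * (4 * r) by ring, hhalf]
      simp [pow_succ, pow_mul]
    · linear_combination (α ^ (4 * r + 1)) * hJ
    · rw [h2, hinv]; ring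

theorem mainTheorem4 {F : Type*} [Field F] [Fintype F] [Algebra (ZMod 3) F] (k : ℕ) (hk : 1 < k)
    (hk4 : ¬ 4 ∣ k) (hF : Fintype.card F = 3 ^ (2 * k)) (a₁ a₂ a₃ : F)
    (ha : IsTrinomialCoeff k a₁ a₂ a₃) :
    IsRegularBent (trinomial k a₁ a₂ a₃) ∧
      HasAlgebraicDegree (trinomial k a₁ a₂ a₃) 4 ∧
      InCompletedMaioranaMcFarland (trinomial k a₁ a₂ a₃) := by
  obtain ⟨κ, α, hκ, hα0, hα, rfl, rfl, ha₃⟩ := ha.exists_twist hk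
  rw [ha₃]
  have hdim : Module.finrank (ZMod 3) F = 2 * k := by
    have h := Module.card_eq_pow_finrank (K := ZMod 3) (V := F)
    rw [hF, ZMod.card] at h
    exact (Nat.pow_right_injective (by norm_num : 2 ≤ 3) h).symm
  let σ : F ≃ₐ[ZMod 3] F := FiniteField.frobeniusAlgEquivOfAlgebraic (ZMod 3) F ^ k
  have hσ_apply (x : F) : σ x = x ^ 3 ^ k := by
    simp only [σ, AlgEquiv.coe_pow, FiniteField.coe_frobeniusAlgEquivOfAlgebraic_iterate, ZMod.card]
  have hσ (x : F) : σ (σ x) = x := by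
    rw [hσ_apply, hσ_apply, ← pow_mul, ← pow_add, ← two_mul, ← hF, FiniteField.pow_card]
  have hσ1 : ∃ x, σ x ≠ x := by
    by_contra! h
    have h1 : σ = 1 := AlgEquiv.ext h
    have h2 := orderOf_dvd_of_pow_eq_one h1
    rw [FiniteField.orderOf_frobeniusAlgEquivOfAlgebraic, hdim] at h2
    have := Nat.le_of_dvd (by omega) h2
    omega
  have h5 (t : F) (ht : σ t = t) (ht5 : t ^ 5 = 1) : t = 1 := by
    have ht0 : t ≠ 0 := by rintro rfl; simp at ht5
    have h1 : t ^ (3 ^ k - 1) = 1 := by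
      refine mul_right_cancel₀ ht0 ?_
      rw [← pow_succ, Nat.sub_add_cancel (Nat.one_le_pow _ _ three_pos), ← hσ_apply, ht, one_mul]
    have h2 := pow_gcd_eq_one.mpr ⟨ht5, h1⟩
    rwa [coprime_five_three_pow_sub_one hk4, pow_one] at h2
  rw [← hσ_apply] at hκ hα
  have hf (x : F) : trinomial k (α ^ 2 * α ^ 3 ^ k) (κ * α ^ 3) α x =
      -Algebra.trace (ZMod 3) F (α ^ 3 * (x + κ * σ x) ^ 5 * (x - κ * σ x)) := by
    rw [← trace_trinomial_eq hσ hκ hα, trinomial, hσ_apply, hσ_apply]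
    congr 1
    ring
  obtain ⟨e, π, hπ⟩ := exists_maioranaMcFarland_eq hσ hσ1 hκ hα0 hα h5 hdim
  have hMM (x : F) := (hf x).trans (hπ x)
  exact ⟨isRegularBent_of_maioranaMcFarland e π 0 hMM,
    hasAlgebraicDegree_four hσ hσ1 hκ hα0 hα hdim hk hf,
    inCompletedMaioranaMcFarland_of_linearEquiv e π 0 hMM⟩
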